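/- Let $\mathbb F_q\subseteq\mathbb F_{q_1}$ be finite fields. For a linear code $\mathcal C\subseteq\mathbb F^n$ and integers $r\ge 1$, $\delta\ge 2$, an $(r,\delta)$-repair set is a set $B\subseteq[n]$ of coordinates with $|B|\le r+\delta-1$ such that for every $l\in B$ and every $L\subseteq B\setminus\{l\}$ with $|L|=\max\{|B|-(\delta-1),0\}$, the symbol $c_l$ is a linear function of $(c_i)_{i\in L}$ for $\mathbf c=(c_1,\dots,c_n)\in\mathcal C$. The code has $(r,\delta)_a$-locality if every coordinate lies in some $(r,\delta)$-repair set. An $[n,k,d]$ code with $(r,\delta)_a$-locality is optimal if every linear code of length $n$ and dimension $k$ with $(r,\delta)_a$-locality, over any finite field, has minimum Hamming distance at most $d$. A set $S\subseteq\mathbb F_{q_1}$ is $t$-wise independent over $\mathbb F_q$ if every $T\subseteq S$ with $|T|\le t$ is linearly independent over $\mathbb F_q$. Let $n=w(r+\delta-1)+m$ and $k=ur+v$ with nonnegative integers $w,m,u,v$, where $\delta\ge2$, $\delta\le m<r+\delta-1$, $$r>v>\max\{m-\delta+1,\lfloor r/2\rfloor\},\qquad u\ge\max\{2(r+\delta-1-m),\,r+\delta-1\},$$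 and suppose that $h:=n-k-(w+1)(\delta-1)\ge 0$ (under these assumptions this is equivalent to $w>u$). Let $A$ be a $(\delta-1)\times(r+\delta-1)$ parity-check matrix over $\mathbb F_q$ of an $[r+\delta-1,r,\delta]_q$ MDS code, and let $A_1$ be $A$ without its last column. Let $S=\{\alpha_1,\dots,\alpha_n\}\subseteq\mathbb F_{q_1}$ be a set of $n$ elements, enumerated in any order, that is $(h+(w-u)(\delta-1))$-wise independent over $\mathbb F_q$, and let $V(S,h)$ be the $h\times n$ matrix whose entry in row $i$ and column $j$ is $\alpha_j^{q^{i-1}}$. Let $\mathcal C(S,h)\subseteq\mathbb F_{q_1}^n$ be the linear code with parity-check matrix $$R=\begin{pmatrix}R_1&0&\cdots&0\\0&R_2&\cdots&0\\ \vdots&\vdots&\ddots&\vdots\\0&0&\cdots&R_{w+1}\\H_1&H_2&\cdots&H_{w+1}\end{pmatrix},\qquad (H_1,\dots,H_{w+1})=V(S,h),$$ where $R_i=A_1$ for $1\le i\le r+\delta-1-m$ and $R_i=A$ for $r+\delta-m\le i\le w+1$. Then $\mathcal C(S,h)$ is an optimal $[n,k,d]_{q_1}$ linear code with $(r,\delta)_a$-locality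 and $d=h+(w-u)(\delta-1)+1$. -/

import Mathlib

universe u v

/-- The linear code `C`, with coordinates indexed by the finite type `ι`, is an `[n, k, d]` code:
it has length `n`, dimension `k` and minimum Hamming distance exactly `d`. -/
structure IsLinearCode {ι : Type*} [Fintype ι] {F : Type*} [Field F]
    (C : Submodule F (ι → F)) (n k d : ℕ) : Prop where
  length_eq : Fintype.card ι = n
  dim_eq : Module.finrank F C = k
  dist_isLeast : open scoped Classical in
    IsLeast {e : ℕ | ∃ x ∈ C, ∃ y ∈ C, x ≠ y ∧ hammingDist x y = e} d

/-- `S` is an `(r, δ)`-repair set of `C`: it has at most `r + δ - 1` elements, and for each `l ∈ S`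
and each `L ⊆ S \ {l}` with `|S| - (δ - 1)` elements, the symbol `c_l` is a linear function of the
symbols `c_i`, `i ∈ L`. The truncated subtraction is intended: if `|S| ≤ δ - 1`, all the symbols of
`S` may be erased at once, so they have to vanish on `C`. -/
def IsRepairSet {ι : Type*} {F : Type*} [Field F]
    (C : Submodule F (ι → F)) (r δ : ℕ) (S : Finset ι) : Prop :=
  S.card ≤ r + δ - 1 ∧
    ∀ l ∈ S, ∀ L : Finset ι, L ⊆ S → l ∉ L → L.card = S.card - (δ - 1) →
      ∃ a : ι → F, ∀ c ∈ C, c l = ∑ i ∈ L, a i * c i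

/-- All-symbol `(r, δ)`-locality: every coordinate lies in an `(r, δ)`-repair set. -/
def HasAllSymbolLocality {ι : Type*} {F : Type*} [Field F]
    (C : Submodule F (ι → F)) (r δ : ℕ) : Prop :=
  ∀ i : ι, ∃ S : Finset ι, i ∈ S ∧ IsRepairSet C r δ S

/-- `C` is an optimal `[n, k, d]` code with all-symbol `(r, δ)`-locality: no code of length `n` and
dimension `k` with all-symbol `(r, δ)`-locality, over any finite field, has a larger minimum
distance. -/
structure IsOptimalLRC {ι : Type*} [Fintype ι] {K : Type u} [Field K]
    (C : Submodule K (ι → K)) (n k d r δ : ℕ) : Prop where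
  isLinearCode : IsLinearCode C n k d
  locality : HasAllSymbolLocality C r δ
  optimal : ∀ (E : Type u) [Field E] [Finite E] (D : Submodule E (Fin n → E)) (d' : ℕ),
    IsLinearCode D n k d' → HasAllSymbolLocality D r δ → d' ≤ d

/-- The code with parity-check matrix `H`. -/
def parityCheckCode {ρ ι F : Type*} [Fintype ι] [Field F] (H : Matrix ρ ι F) :
    Submodule F (ι → F) :=
  LinearMap.ker H.mulVecLin

/-- `S ⊆ K` is `t`-wise independent over `F`: every `T ⊆ S` with `|T| ≤ t` is linearly
independent over `F`. -/
def IsWiseIndependent (F : Type*) {K : Type*} [Field F] [Field K] [Algebra F K]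
    (t : ℕ) (S : Set K) : Prop :=
  ∀ T : Finset K, (T : Set K) ⊆ S → T.card ≤ t →
    LinearIndependent F (fun x : T => (x : K))

/-- The matrix with entries `α_j ^ (q ^ i)`, `0 ≤ i < h`. -/
def mooreMatrix {ι K : Type*} [Field K] (q h : ℕ) (α : ι → K) : Matrix (Fin h) ι K :=
  Matrix.of fun i j => α j ^ q ^ (i : ℕ)

namespace ConstructionA

/-- The number of columns of the `i`-th diagonal block, with `i` counted from `0`: the first
`r + δ - 1 - m` blocks have `r + δ - 2` columns, the others have `r + δ - 1`. -/
def blockSize (r δ m i : ℕ) : ℕ :=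
  if i < r + δ - 1 - m then r + δ - 2 else r + δ - 1

theorem blockSize_le (r δ m i : ℕ) : blockSize r δ m i ≤ r + δ - 1 := by
  unfold blockSize
  split <;> omega

/-- The coordinates of the code: pairs of a block `i` and a position inside this block. -/
abbrev Coord (r δ m w : ℕ) : Type :=
  (i : Fin (w + 1)) × Fin (blockSize r δ m i)

/-- The parity-check matrix: the `i`-th diagonal block consists of the first `blockSize r δ m i`
columns of `A` (so it is `A` or `A` without its last column), and the last `h` rows are
the matrix of the powers `α_j ^ (q ^ i)`, where `q = |F|`. -/
def parityCheck {F K : Type*} [Field F] [Fintype F] [Field K] [Algebra F K] (r δ m w h : ℕ)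
    (A : Matrix (Fin (δ - 1)) (Fin (r + δ - 1)) F) (α : Coord r δ m w → K) :
    Matrix ((Fin (w + 1) × Fin (δ - 1)) ⊕ Fin h) (Coord r δ m w) K :=
  Matrix.fromRows
    (Matrix.of fun a j =>
      if a.1 = j.1 then
        algebraMap F K (A a.2 (Fin.castLE (blockSize_le r δ m j.1) j.2))
      else 0)
    (mooreMatrix (Fintype.card F) h α)

/-- The code with the above parity-check matrix. -/
def code {F K : Type*} [Field F] [Fintype F] [Field K] [Algebra F K] (r δ m w h : ℕ)
    (A : Matrix (Fin (δ - 1)) (Fin (r + δ - 1)) F) (α : Coord r δ m w → K) :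
    Submodule K (Coord r δ m w → K) :=
  parityCheckCode (parityCheck r δ m w h A α)

end ConstructionA

/-! Put D = r + δ - 1. The claimed distance equals n - k + 1 - (u + 1)(δ - 1).

Upper bound. For the coordinate functionals of a code, a set T of rank below k forces d ≤ n - k + 1
- (|T| - rk T) (`IsLinearCode.dist_le_of_rk_lt`). A better code would thus have nullity |T| - rk T
below (u + 1)(δ - 1) for all such T. Each repair set outside the span of the preceding ones raises
the nullity by at least δ - 1, so small nullity leaves little room for overlap: the union of j ≤ u +
1 repair sets with different nonzero spans has at least jD - (r - v) elements
(`HasSmallNullity.isChainUnion_biUnion`, `HasSmallNullity.le_card`). But covering almost all of the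
n = wD + m coordinates takes at least w + 1 repair sets, whose union falls short of their number
times D by at least D - m. A shortfall of D - m already occurs for at most 2(D - m) ≤ u of them
(`exists_small_deficient`), and D - m > r - v because v > m - δ + 1.

Lower bound. A codeword supported on a set T of at most h + (w - u)(δ - 1) coordinates is a
K-combination of F-words that satisfy the block checks and live on T. These form a space of
dimension s ≤ h, and the global checks say that a Moore matrix of s elements kills the coefficients.
The s elements are independent over F because the α_j, j ∈ T, are, so the codeword is zero
(`ConstructionA.eq_zero_of_mem_code`). The dimension k follows by counting checks from below and
correctable erasures from above. -/

namespace LRCBound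

open Module Submodule

/-! ### Rank and nullity of families of vectors covered by repair sets -/

section Rank

variable {ι E V : Type*} [Field E] [AddCommGroup V] [Module E V]

/-- The span of the vectors `φ i`, `i ∈ T`. -/
def spanOn (E : Type*) {ι V : Type*} [Field E] [AddCommGroup V] [Module E V]
    (φ : ι → V) (T : Finset ι) : Submodule E V :=
  span E (Set.image φ T)

/-- The rank of the family `φ i`, `i ∈ T`. -/
noncomputable def rk (E : Type*) {ι V : Type*} [Field E] [AddCommGroup V] [Module E V]
    (φ : ι → V) (T : Finset ι) : ℕ :=
  finrank E (spanOn E φ T)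

theorem mem_spanOn {φ : ι → V} {T : Finset ι} {i : ι} (hi : i ∈ T) : φ i ∈ spanOn E φ T :=
  subset_span ⟨i, hi, rfl⟩

theorem spanOn_le {φ : ι → V} {T : Finset ι} {W : Submodule E V} (h : ∀ i ∈ T, φ i ∈ W) :
    spanOn E φ T ≤ W := by
  refine span_le.2 ?_
  rintro _ ⟨i, hi, rfl⟩
  exact h i hi

theorem spanOn_mono {φ : ι → V} {S T : Finset ι} (h : S ⊆ T) : spanOn E φ S ≤ spanOn E φ T :=
  spanOn_le fun _ hi => mem_spanOn (h hi)

theorem spanOn_union [DecidableEq ι] (φ : ι → V) (S T : Finset ι) :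
    spanOn E φ (S ∪ T) = spanOn E φ S ⊔ spanOn E φ T := by
  simp [spanOn, Set.image_union, span_union]

theorem rk_empty (φ : ι → V) : rk E φ ∅ = 0 := by
  rw [rk, spanOn, Finset.coe_empty, Set.image_empty, span_empty, finrank_bot]

theorem rk_le_card (φ : ι → V) (T : Finset ι) : rk E φ T ≤ T.card := by
  classical
  have h := finrank_span_finset_le_card (R := E) (T.image φ)
  rw [Set.finrank, Finset.coe_image] at h
  exact h.trans Finset.card_image_le

theorem rk_le_of_le [FiniteDimensional E V] {φ : ι → V} {S T : Finset ι}
    (h : spanOn E φ S ≤ spanOn E φ T) :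
    rk E φ S ≤ rk E φ T :=
  finrank_mono h

theorem rk_union_le [FiniteDimensional E V] [DecidableEq ι] (φ : ι → V) (S T : Finset ι) :
    rk E φ (S ∪ T) ≤ rk E φ S + rk E φ T := by
  rw [rk, spanOn_union]
  exact finrank_add_le_finrank_add_finrank _ _

/-- The linear-algebraic content of being an `(r, δ)`-repair set: after the removal of any
`δ - 1` elements, the remaining vectors span the same space. -/
def IsSpanRepair (E : Type*) {ι V : Type*} [Field E] [AddCommGroup V] [Module E V]
    (φ : ι → V) (r δ : ℕ) (B : Finset ι) : Prop :=
  B.card ≤ r + δ - 1 ∧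
    ∀ L ⊆ B, B.card ≤ L.card + (δ - 1) → spanOn E φ B ≤ spanOn E φ L

variable {φ : ι → V} {r δ : ℕ}

/-- A repair set that is not in the span of `T` raises the nullity by at least `δ - 1`. -/
theorem IsSpanRepair.rk_union [FiniteDimensional E V] [DecidableEq ι] {B : Finset ι}
    (hB : IsSpanRepair E φ r δ B) {T : Finset ι}
    (hBT : ¬ spanOn E φ B ≤ spanOn E φ T) :
    rk E φ (T ∪ B) + (δ - 1) + T.card ≤ rk E φ T + (T ∪ B).card := by
  classical
  set Bc := B.filter (fun i => φ i ∈ spanOn E φ T) with hBc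
  set Bo := B.filter (fun i => φ i ∉ spanOn E φ T) with hBo
  have hcard : Bc.card + Bo.card = B.card := Finset.card_filter_add_card_filter_not _
  have hBcT : spanOn E φ Bc ≤ spanOn E φ T := spanOn_le fun i hi => (Finset.mem_filter.1 hi).2
  -- Otherwise `Bc` alone would span `B`, putting `B` inside the span of `T`. Discarding δ - 1
  -- elements `Y` of `Bo` then costs no rank, while all of `Bo` counts towards the size.
  have hlarge : δ - 1 ≤ Bo.card := by
    by_contra hlt
    exact hBT ((hB.2 Bc (Finset.filter_subset _ _) (by omega)).trans hBcT)
  obtain ⟨Y, hYB, hY⟩ := Finset.exists_subset_card_eq hlarge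
  have hYB' : Y ⊆ B := hYB.trans (Finset.filter_subset _ _)
  have h1 : spanOn E φ B ≤ spanOn E φ (B \ Y) := by
    refine hB.2 _ Finset.sdiff_subset ?_
    have := Finset.card_sdiff_add_card_eq_card hYB'
    omega
  have h2 : spanOn E φ (T ∪ B) ≤ spanOn E φ (T ∪ (Bo \ Y)) := by
    rw [spanOn_union]
    refine sup_le (spanOn_mono Finset.subset_union_left) (h1.trans (spanOn_le fun i hi => ?_))
    rw [Finset.mem_sdiff] at hi
    by_cases hiT : φ i ∈ spanOn E φ T
    · exact spanOn_mono Finset.subset_union_left hiT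
    · refine mem_spanOn (Finset.mem_union_right _ (Finset.mem_sdiff.2 ⟨?_, hi.2⟩))
      exact Finset.mem_filter.2 ⟨hi.1, hiT⟩
  have h3 : rk E φ (T ∪ B) ≤ rk E φ T + (Bo \ Y).card :=
    (rk_le_of_le h2).trans ((rk_union_le _ _ _).trans (by gcongr; exact rk_le_card _ _))
  have h4 := Finset.card_sdiff_add_card_eq_card hYB
  have h5 : T.card + Bo.card ≤ (T ∪ B).card := by
    rw [← Finset.card_union_of_disjoint]
    · exact Finset.card_le_card
        (Finset.union_subset_union_right (Finset.filter_subset _ _))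
    · refine Finset.disjoint_left.2 fun i hi hi' => (Finset.mem_filter.1 hi').2 (mem_spanOn hi)
  omega

theorem IsSpanRepair.rk_le [FiniteDimensional E V] {B : Finset ι}
    (hB : IsSpanRepair E φ r δ B) : rk E φ B ≤ r := by
  obtain ⟨L, hLB, hL⟩ := Finset.exists_subset_card_eq (Nat.sub_le B.card (δ - 1))
  have h1 := rk_le_of_le (hB.2 L hLB (by omega))
  have h2 := rk_le_card (E := E) φ L
  have h3 := hB.1
  omega

/-- A family of vectors of rank at least `u * r + v`, covered by repair sets, in which every set
of smaller rank has nullity less than `(u + 1) * (δ - 1)`. -/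
structure HasSmallNullity (E : Type*) {ι V : Type*} [Fintype ι] [Field E] [AddCommGroup V]
    [Module E V] (φ : ι → V) (r δ u v : ℕ) : Prop where
  cover : ∀ i, ∃ B, i ∈ B ∧ IsSpanRepair E φ r δ B
  le_rk : u * r + v ≤ rk E φ Finset.univ
  card_lt : ∀ T, rk E φ T < u * r + v → T.card < rk E φ T + (u + 1) * (δ - 1)

/-- The size and the nullity of `T` are in the range that is attained by unions of `j` repair sets,
each of which is not in the span of the preceding ones. -/
def IsChainUnion (E : Type*) {ι V : Type*} [Field E] [AddCommGroup V] [Module E V]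
    (φ : ι → V) (r δ j : ℕ) (T : Finset ι) : Prop :=
  rk E φ T + j * (δ - 1) ≤ T.card ∧ T.card ≤ j * (r + δ - 1)

theorem isChainUnion_empty : IsChainUnion E φ r δ 0 ∅ := by
  simp [IsChainUnion, rk_empty]

theorem IsChainUnion.union [FiniteDimensional E V] [DecidableEq ι] {j : ℕ} {T B : Finset ι}
    (hT : IsChainUnion E φ r δ j T)
    (hB : IsSpanRepair E φ r δ B) (hBT : ¬ spanOn E φ B ≤ spanOn E φ T) :
    IsChainUnion E φ r δ (j + 1) (T ∪ B) := by
  have h1 := hB.rk_union hBT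
  have h2 := Finset.card_union_le T B
  have h3 := hB.1
  obtain ⟨h4, h5⟩ := hT
  constructor
  · rw [add_one_mul]; omega
  · rw [add_one_mul]; omega

theorem IsChainUnion.rk_le (hδ : 2 ≤ δ) {j : ℕ} {T : Finset ι} (hT : IsChainUnion E φ r δ j T) :
    rk E φ T ≤ j * r := by
  obtain ⟨h4, h5⟩ := hT
  have : j * (r + δ - 1) = j * r + j * (δ - 1) := by
    rw [← mul_add]; congr 1; omega
  omega

/-- A set of repair sets with nonzero, pairwise different spans. -/
structure IsSpanSeparated (E : Type*) {ι V : Type*} [Field E] [AddCommGroup V] [Module E V]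
    (φ : ι → V) (r δ : ℕ) (G : Finset (Finset ι)) : Prop where
  repair : ∀ B ∈ G, IsSpanRepair E φ r δ B
  ne_bot : ∀ B ∈ G, spanOn E φ B ≠ ⊥
  injOn : Set.InjOn (spanOn E φ) (G : Set (Finset ι))

/-- A system of representatives, one repair set for each nonzero span. -/
theorem exists_isSpanSeparated [Finite ι] (φ : ι → V) (r δ : ℕ) :
    ∃ 𝒢 : Finset (Finset ι), IsSpanSeparated E φ r δ 𝒢 ∧
      ∀ B, IsSpanRepair E φ r δ B → spanOn E φ B ≠ ⊥ →
        ∃ B' ∈ 𝒢, spanOn E φ B' = spanOn E φ B := by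
  classical
  have := Fintype.ofFinite ι
  obtain ⟨𝒢, hsub, hbij⟩ := Set.exists_subset_bijOn
    {B : Finset ι | IsSpanRepair E φ r δ B ∧ spanOn E φ B ≠ ⊥} (spanOn E φ)
  refine ⟨𝒢.toFinset, ⟨fun B hB => (hsub (Set.mem_toFinset.1 hB)).1,
    fun B hB => (hsub (Set.mem_toFinset.1 hB)).2, by simpa using hbij.injOn⟩, fun B hB hB0 => ?_⟩
  obtain ⟨_, hmem, h⟩ := hbij.surjOn ⟨B, ⟨hB, hB0⟩, rfl⟩
  exact ⟨_, Set.mem_toFinset.2 hmem, h⟩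

/-- If the total size of the members of `𝒢` exceeds the size of their union by much, then this is
visible on a small part of `𝒢`. -/
theorem exists_small_deficient [DecidableEq ι] {D a : ℕ} {𝒢 : Finset (Finset ι)}
    (hD : ∀ B ∈ 𝒢, B.card ≤ D)
    (h𝒢 : (𝒢.biUnion id).card + a ≤ 𝒢.card * D) {s : ℕ} (hs : s ≤ a) :
    ∃ G ⊆ 𝒢, G.card ≤ 2 * s ∧ (G.biUnion id).card + s ≤ G.card * D := by
  induction s with
  | zero => exact ⟨∅, by simp⟩
  | succ s ih =>
    obtain ⟨G, hG, hcard, hle⟩ := ih (by omega)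
    by_contra! hno
    -- If the deficiency cannot be raised from s by adding one or two members, every remaining
    -- member has full size D, misses the union of `G`, and is disjoint from the other remaining
    -- members. The total deficiency is then only s < a.
    have heq : (G.biUnion id).card + s = G.card * D := by
      have := hno G hG (by omega)
      omega
    have hone : ∀ B ∈ 𝒢 \ G, (B ∪ G.biUnion id).card = D + (G.biUnion id).card := by
      intro B hB
      rw [Finset.mem_sdiff] at hB
      have h1 := hno (insert B G) (Finset.insert_subset hB.1 hG)
        (by rw [Finset.card_insert_of_notMem hB.2]; omega)
      rw [Finset.card_insert_of_notMem hB.2, Finset.biUnion_insert, id, add_one_mul] at h1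
      have h2 := Finset.card_union_le B (G.biUnion id)
      have h3 := hD B hB.1
      omega
    have hcardD : ∀ B ∈ 𝒢 \ G, B.card = D := by
      intro B hB
      have h1 := hone B hB
      have h2 := Finset.card_union_le B (G.biUnion id)
      have h3 := hD B (Finset.mem_sdiff.1 hB).1
      omega
    have hdisjG : Disjoint ((𝒢 \ G).biUnion id) (G.biUnion id) := by
      rw [Finset.disjoint_biUnion_left]
      intro B hB
      rw [← Finset.card_union_eq_card_add_card, id, hone B hB, hcardD B hB]
    have hpair : ((𝒢 \ G : Finset (Finset ι)) : Set (Finset ι)).PairwiseDisjoint id := by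
      intro B hB B' hB' hne
      have hB1 := Finset.mem_sdiff.1 (Finset.mem_coe.1 hB)
      have hB1' := Finset.mem_sdiff.1 (Finset.mem_coe.1 hB')
      have hnot : B ∉ insert B' G := by
        simp [hne, hB1.2]
      have h1 := hno (insert B (insert B' G))
        (Finset.insert_subset hB1.1 (Finset.insert_subset hB1'.1 hG))
        (by rw [Finset.card_insert_of_notMem hnot, Finset.card_insert_of_notMem hB1'.2]; omega)
      rw [Finset.card_insert_of_notMem hnot, Finset.card_insert_of_notMem hB1'.2,
        Finset.biUnion_insert, Finset.biUnion_insert, id, id, add_one_mul, add_one_mul,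
        ← Finset.union_assoc] at h1
      have h2 := Finset.card_union_le (B ∪ B') (G.biUnion id)
      have h3 := Finset.card_union_add_card_inter B B'
      have h4 := hcardD B hB
      have h5 := hcardD B' hB'
      rw [Function.onFun, id, id, Finset.disjoint_iff_inter_eq_empty, ← Finset.card_eq_zero]
      omega
    have hunion : 𝒢.biUnion id = (𝒢 \ G).biUnion id ∪ G.biUnion id := by
      rw [← Finset.union_biUnion, Finset.sdiff_union_of_subset hG]
    have h6 : ((𝒢 \ G).biUnion id).card = (𝒢 \ G).card * D := by
      rw [Finset.card_biUnion hpair]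
      exact Finset.sum_const_nat hcardD
    have h7 : 𝒢.card * D = (𝒢 \ G).card * D + G.card * D := by
      rw [← add_mul, Finset.card_sdiff_add_card_eq_card hG]
    rw [hunion, Finset.card_union_of_disjoint hdisjG, h6] at h𝒢
    omega

variable [FiniteDimensional E V] [Fintype ι] [DecidableEq ι] {u v : ℕ}

/-- Extension of a set by `i` further repair sets. -/
theorem HasSmallNullity.exists_extension (H : HasSmallNullity E φ r δ u v)
    (T : Finset ι) (i : ℕ) (hi : rk E φ T + i * r < u * r + v + r) :
    ∃ T', rk E φ T' + i * (δ - 1) + T.card ≤ rk E φ T + T'.card ∧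
      rk E φ T' ≤ rk E φ T + i * r ∧ T'.card ≤ T.card + i * (r + δ - 1) := by
  induction i with
  | zero => exact ⟨T, by simp⟩
  | succ i ih =>
    rw [add_one_mul] at hi
    obtain ⟨T', h1, h2, h3⟩ := ih (by omega)
    -- By `hi`, the rank before the last extension is still below u * r + v, so some vector lies
    -- outside the span.
    have hlt : ¬ spanOn E φ Finset.univ ≤ spanOn E φ T' := fun hle => by
      have := rk_le_of_le hle
      have := H.le_rk
      omega
    obtain ⟨x, hx⟩ : ∃ x, φ x ∉ spanOn E φ T' := by
      by_contra! hall
      exact hlt (spanOn_le fun i _ => hall i)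
    obtain ⟨B, hxB, hB⟩ := H.cover x
    have hBT : ¬ spanOn E φ B ≤ spanOn E φ T' := fun hle => hx (hle (mem_spanOn hxB))
    have h4 := hB.rk_union hBT
    have h5 := rk_union_le (E := E) φ T' B
    have h6 := hB.rk_le
    have h7 := Finset.card_union_le T' B
    have h8 := hB.1
    refine ⟨T' ∪ B, ?_, ?_, ?_⟩ <;> rw [add_one_mul] <;> omega

/-- Extending `T` to u + 1 steps gives nullity at least (u + 1)(δ - 1), so the rank must reach u * r
+ v. The extended set then has at least (u + 1)D - (r - v) elements, and each added step accounts
for at most D of them. -/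
theorem HasSmallNullity.le_card (H : HasSmallNullity E φ r δ u v) (hδ : 2 ≤ δ) (hv : 0 < v)
    (hvr : v < r) {j : ℕ} (hj : j ≤ u + 1) {T : Finset ι} (hT : IsChainUnion E φ r δ j T) :
    j * (r + δ - 1) ≤ T.card + (r - v) := by
  obtain ⟨i, hi⟩ := Nat.exists_eq_add_of_le hj
  have hr := hT.rk_le hδ
  have e1 : u * r + r = j * r + i * r := by rw [← add_one_mul, hi, add_mul]
  obtain ⟨T', h1, h2, h3⟩ := H.exists_extension T i (by omega)
  have e2 : (u + 1) * (δ - 1) = j * (δ - 1) + i * (δ - 1) := by rw [hi, add_mul]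
  have e3 : (u + 1) * (r + δ - 1) = j * (r + δ - 1) + i * (r + δ - 1) := by rw [hi, add_mul]
  have e4 : (u + 1) * (r + δ - 1) = u * r + r + (u + 1) * (δ - 1) := by
    rw [← add_one_mul, ← mul_add]; congr 1; omega
  have h4 := hT.1
  have h5 : u * r + v ≤ rk E φ T' := by
    by_contra hlt
    have := H.card_lt T' (by omega)
    omega
  omega

/-- With δ - 1 further elements in the span, an extension to u steps would have rank at most u * r
but nullity at least (u + 1)(δ - 1). -/
theorem HasSmallNullity.card_closure (H : HasSmallNullity E φ r δ u v) (hδ : 2 ≤ δ) (hv : 0 < v)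
    {j : ℕ} (hj : j ≤ u) {T : Finset ι} (hT : IsChainUnion E φ r δ j T)
    {X : Finset ι} (hX : ∀ x ∈ X, φ x ∈ spanOn E φ T) (hXT : Disjoint T X) :
    X.card ≤ δ - 2 := by
  obtain ⟨i, hi⟩ := Nat.exists_eq_add_of_le hj
  have hr := hT.rk_le hδ
  have e1 : u * r = j * r + i * r := by rw [hi, add_mul]
  have hrk : rk E φ (T ∪ X) ≤ rk E φ T := by
    refine rk_le_of_le ?_
    rw [spanOn_union]
    exact sup_le le_rfl (spanOn_le hX)
  obtain ⟨T', h1, h2, h3⟩ := H.exists_extension (T ∪ X) i (by omega)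
  have h4 := H.card_lt T' (by omega)
  have h5 := Finset.card_union_of_disjoint hXT
  have e2 : (u + 1) * (δ - 1) = j * (δ - 1) + i * (δ - 1) + (δ - 1) := by
    rw [add_one_mul, hi, add_mul]
  have h6 := hT.1
  have h7 : rk E φ T ≤ rk E φ (T ∪ X) := rk_le_of_le (spanOn_mono Finset.subset_union_left)
  by_contra hlt
  omega

/-- Two repair sets with different spans meet in at most `v` elements. -/
theorem HasSmallNullity.card_inter_le (H : HasSmallNullity E φ r δ u v) (hδ : 2 ≤ δ)
    (hvr : v < r) (hv : r < 2 * v) (hu : 1 ≤ u) {B B' : Finset ι}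
    (hB : IsSpanRepair E φ r δ B) (hB' : IsSpanRepair E φ r δ B')
    (hB0 : spanOn E φ B ≠ ⊥) (hB'0 : spanOn E φ B' ≠ ⊥)
    (hne : spanOn E φ B ≠ spanOn E φ B') : (B ∩ B').card ≤ v := by
  have hbot : spanOn E φ ∅ = ⊥ := by simp [spanOn]
  -- As the spans differ, one of the two sets is not in the span of the other and can be added
  -- second. The overlap is then at most r - v, which is below v.
  have key : IsChainUnion E φ r δ 2 (B ∪ B') := by
    have single : ∀ S, IsSpanRepair E φ r δ S → spanOn E φ S ≠ ⊥ → IsChainUnion E φ r δ 1 S := by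
      intro S hS hS0
      have := isChainUnion_empty.union hS (by rwa [hbot, le_bot_iff])
      simpa using this
    by_cases hle : spanOn E φ B' ≤ spanOn E φ B
    · rw [Finset.union_comm]
      exact (single B' hB' hB'0).union hB fun h => hne (le_antisymm h hle)
    · exact (single B hB hB0).union hB' hle
  have h1 := H.le_card hδ (by omega) hvr (by omega) key
  have h2 := Finset.card_union_add_card_inter B B'
  have h3 := hB.1
  have h4 := hB'.1
  omega

/-- The point is that no member `B` is in the span of the others. If it were, it would add at most δ
- 2 elements to their union; but starting the chain with `B` instead shows that the same union must
be almost a full D larger than the others allow. -/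
theorem HasSmallNullity.isChainUnion_biUnion (H : HasSmallNullity E φ r δ u v) (hδ : 2 ≤ δ)
    (hvr : v < r) (hv : r < 2 * v) (hu : 1 ≤ u) {𝒢 : Finset (Finset ι)}
    (h𝒢 : IsSpanSeparated E φ r δ 𝒢) (G : Finset (Finset ι)) (hG : G ⊆ 𝒢)
    (hcard : G.card ≤ u + 1) : IsChainUnion E φ r δ G.card (G.biUnion id) := by
  induction G using Finset.strongInduction with
  | H G ih =>
    obtain rfl | ⟨B, hBG⟩ := G.eq_empty_or_nonempty
    · simpa using isChainUnion_empty
    obtain ⟨G', hBG', rfl⟩ : ∃ G', B ∉ G' ∧ insert B G' = G :=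
      ⟨G.erase B, Finset.notMem_erase _ _, Finset.insert_erase hBG⟩
    rw [Finset.card_insert_of_notMem hBG'] at hcard ⊢
    have hB𝒢 : B ∈ 𝒢 := hG (Finset.mem_insert_self _ _)
    have hG'𝒢 : G' ⊆ 𝒢 := (Finset.subset_insert _ _).trans hG
    have sub : ∀ G'' ⊆ G', IsChainUnion E φ r δ G''.card (G''.biUnion id) := by
      intro G'' hG''
      have hle := Finset.card_le_card hG''
      exact ih G'' (hG''.trans_ssubset (Finset.ssubset_insert hBG')) (hG''.trans hG'𝒢) (by omega)
    have hch := sub G' subset_rfl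
    rw [Finset.biUnion_insert, id, Finset.union_comm]
    refine hch.union (h𝒢.repair B hB𝒢) fun hle => ?_
    have hBU : (B \ G'.biUnion id).card ≤ δ - 2 :=
      H.card_closure hδ (by omega) (by omega) hch
        (fun x hx => hle (mem_spanOn (Finset.sdiff_subset hx))) Finset.disjoint_sdiff
    -- A member `B'` spanned by `B` and `G''` would have at most δ - 2 elements outside them and at
    -- most v in `B`, hence at most v + δ - 2 outside `G''`. The chain without `B` demands at least
    -- v + δ - 1.
    have claim : ∀ G'' ⊆ G', IsChainUnion E φ r δ (G''.card + 1) (B ∪ G''.biUnion id) := by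
      intro G''
      induction G'' using Finset.induction_on with
      | empty =>
        intro _
        have := isChainUnion_empty.union (h𝒢.repair B hB𝒢)
          (by simpa [spanOn] using h𝒢.ne_bot B hB𝒢)
        simpa using this
      | insert B' G'' hB' ih' =>
        intro hsub
        have hB'G' : B' ∈ G' := hsub (Finset.mem_insert_self _ _)
        have hG''G' : G'' ⊆ G' := (Finset.subset_insert _ _).trans hsub
        have hc1 := ih' hG''G'
        have hle1 := Finset.card_le_card hsub
        have hc2 := sub _ hsub
        rw [Finset.card_insert_of_notMem hB'] at hle1 hc2 ⊢
        rw [Finset.biUnion_insert, id] at hc2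
        have hc3 := sub _ hG''G'
        rw [Finset.biUnion_insert, id, Finset.union_comm B', ← Finset.union_assoc]
        refine hc1.union (h𝒢.repair B' (hG'𝒢 hB'G')) fun hle' => ?_
        have h1 : (B' \ (B ∪ G''.biUnion id)).card ≤ δ - 2 :=
          H.card_closure hδ (by omega) (by omega) hc1
            (fun x hx => hle' (mem_spanOn (Finset.sdiff_subset hx))) Finset.disjoint_sdiff
        have h2 := H.le_card hδ (by omega) hvr (by omega) hc2
        have h3 := hc3.2
        have hne : B ≠ B' := fun h => hBG' (h ▸ hB'G')
        have h4 := H.card_inter_le hδ hvr hv hu (h𝒢.repair B hB𝒢)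
          (h𝒢.repair B' (hG'𝒢 hB'G')) (h𝒢.ne_bot B hB𝒢) (h𝒢.ne_bot B' (hG'𝒢 hB'G'))
          (fun h => hne (h𝒢.injOn hB𝒢 (hG'𝒢 hB'G') h))
        have h5 : (B' ∪ G''.biUnion id).card ≤
            (B' \ (B ∪ G''.biUnion id)).card + (B ∩ B').card + (G''.biUnion id).card := by
          refine (Finset.card_le_card ?_).trans ((Finset.card_union_le _ _).trans
            (Nat.add_le_add_right (Finset.card_union_le _ _) _))
          intro x
          simp only [Finset.mem_union, Finset.mem_sdiff, Finset.mem_inter]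
          tauto
        rw [add_one_mul] at h2
        omega
    have h1 := H.le_card hδ (by omega) hvr (by omega) (claim G' subset_rfl)
    have h2 := hch.2
    have h3 : (B ∪ G'.biUnion id).card ≤ (B \ G'.biUnion id).card + (G'.biUnion id).card := by
      rw [← Finset.card_union_of_disjoint Finset.sdiff_disjoint, Finset.sdiff_union_self_eq_union]
    rw [add_one_mul] at h1
    omega

/-- Families with small nullity do not exist for the parameters in question. -/
theorem not_hasSmallNullity {w m : ℕ} (hδ : 2 ≤ δ) (hcard : Fintype.card ι = w * (r + δ - 1) + m)
    (hδm : δ ≤ m) (hm : m < r + δ - 1) (hvr : v < r) (hmv : m - δ + 1 < v) (hv : r < 2 * v)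
    (hu1 : 2 * (r + δ - 1 - m) ≤ u) (hu2 : δ - 1 ≤ u) : ¬ HasSmallNullity E φ r δ u v := by
  intro H
  obtain ⟨𝒢, h𝒢, hall⟩ := exists_isSpanSeparated (E := E) φ r δ
  have hu : 1 ≤ u := by omega
  have hchain := H.isChainUnion_biUnion hδ hvr hv hu h𝒢
  have hx : ∀ x, ∃ G ⊆ 𝒢, G.card ≤ 1 ∧ φ x ∈ spanOn E φ (G.biUnion id) := by
    intro x
    obtain ⟨B, hxB, hB⟩ := H.cover x
    by_cases hB0 : spanOn E φ B = ⊥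
    · refine ⟨∅, by simp, by simp, ?_⟩
      have : φ x ∈ spanOn E φ B := mem_spanOn hxB
      rw [hB0, mem_bot] at this
      rw [this]
      exact zero_mem _
    · obtain ⟨B', hB', h⟩ := hall B hB hB0
      refine ⟨{B'}, by simpa using hB', by simp, ?_⟩
      rw [Finset.singleton_biUnion, id, h]
      exact mem_spanOn hxB
  choose g hg𝒢 hg1 hgx using hx
  -- Any δ - 1 uncovered elements would lie in the span of at most δ - 1 ≤ u members, against
  -- `HasSmallNullity.card_closure`.
  have hout : (Finset.univ \ 𝒢.biUnion id).card ≤ δ - 2 := by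
    by_contra hlt
    obtain ⟨X, hXsub, hX⟩ := Finset.exists_subset_card_eq
      (show δ - 1 ≤ (Finset.univ \ 𝒢.biUnion id).card by omega)
    have hG𝒢 : X.biUnion g ⊆ 𝒢 := Finset.biUnion_subset.2 fun x _ => hg𝒢 x
    have hGcard : (X.biUnion g).card ≤ δ - 1 := by
      have := Finset.card_biUnion_le_card_mul X g 1 fun x _ => hg1 x
      omega
    have := H.card_closure hδ (by omega) (by omega) (hchain _ hG𝒢 (by omega)) (X := X)
      (fun x hx => spanOn_mono
        (Finset.biUnion_subset_biUnion_of_subset_left _ (Finset.subset_biUnion_of_mem g hx))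
        (hgx x))
      (Finset.disjoint_left.2 fun x hx hxX => (Finset.mem_sdiff.1 (hXsub hxX)).2
        (Finset.biUnion_subset_biUnion_of_subset_left _ hG𝒢 hx))
    omega
  have h1 := Finset.card_sdiff_add_card_eq_card (Finset.subset_univ (𝒢.biUnion id))
  rw [Finset.card_univ, hcard] at h1
  have hD : ∀ B ∈ 𝒢, B.card ≤ r + δ - 1 := fun B hB => (h𝒢.repair B hB).1
  have h2 := Finset.card_biUnion_le_card_mul 𝒢 id _ hD
  -- At most w members cover at most w * D elements, leaving at least m > δ - 2 uncovered.
  have hw : w < 𝒢.card := by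
    by_contra hle
    have := Nat.mul_le_mul_right (r + δ - 1) (not_lt.1 hle)
    omega
  have h3 := Nat.mul_le_mul_right (r + δ - 1) (Nat.succ_le_of_lt hw)
  rw [Nat.succ_eq_add_one, add_one_mul] at h3
  obtain ⟨G, hG, hGcard, hGdef⟩ := exists_small_deficient (a := r + δ - 1 - m) hD (by omega) le_rfl
  have h4 := H.le_card hδ (by omega) hvr (by omega) (hchain G hG (by omega))
  omega

end Rank

end LRCBound

/-! ### From codes to coordinate functionals: the distance bound -/

namespace LRCBound

open Module Submodule

section Code

variable {ι E : Type*} [Field E]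

/-- The coordinate functionals of a code. -/
def coordFunctional (D : Submodule E (ι → E)) (i : ι) : Dual E D :=
  (LinearMap.proj i).comp D.subtype

theorem _root_.IsRepairSet.isSpanRepair {D : Submodule E (ι → E)} {r δ : ℕ} {B : Finset ι}
    (hB : IsRepairSet D r δ B) : IsSpanRepair E (coordFunctional D) r δ B := by
  refine ⟨hB.1, fun L hLB hcard => spanOn_le fun l hl => ?_⟩
  by_cases hlL : l ∈ L
  · exact mem_spanOn hlL
  obtain ⟨L', hL'L, hL'⟩ := Finset.exists_subset_card_eq
    (show B.card - (δ - 1) ≤ L.card by omega)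
  obtain ⟨a, ha⟩ := hB.2 l hl L' (hL'L.trans hLB) (fun h => hlL (hL'L h)) hL'
  have hsum : coordFunctional D l = ∑ i ∈ L', a i • coordFunctional D i := by
    ext c
    simpa [coordFunctional] using ha c c.2
  rw [hsum]
  exact sum_mem fun i hi => smul_mem _ _ (mem_spanOn (hL'L hi))

variable [Fintype ι]

/-- The codewords vanishing on `T` are the annihilator of the span of its functionals, of dimension
`finrank E D - rk T`. -/
theorem exists_ne_zero_of_rk_lt {D : Submodule E (ι → E)} {T : Finset ι}
    (hT : rk E (coordFunctional D) T < finrank E D) :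
    ∃ x ∈ D, x ≠ 0 ∧ ∀ i ∈ T, x i = 0 := by
  have h := Subspace.finrank_add_finrank_dualCoannihilator_eq (spanOn E (coordFunctional D) T)
  rw [rk] at hT
  have hne : (spanOn E (coordFunctional D) T).dualCoannihilator ≠ ⊥ := by
    intro h0
    rw [h0, finrank_bot] at h
    omega
  obtain ⟨x, hx, hx0⟩ := exists_mem_ne_zero_of_ne_bot hne
  refine ⟨x, x.2, by simpa using hx0, fun i hi => ?_⟩
  rw [mem_dualCoannihilator] at hx
  exact hx _ (mem_spanOn hi)

theorem le_rk_univ (D : Submodule E (ι → E)) :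
    finrank E D ≤ rk E (coordFunctional D) Finset.univ := by
  by_contra hlt
  obtain ⟨x, -, hx0, hx⟩ := exists_ne_zero_of_rk_lt (not_le.1 hlt)
  exact hx0 (funext fun i => hx i (Finset.mem_univ i))

/-- A set of coordinates of small rank and large nullity bounds the minimum distance. -/
theorem _root_.IsLinearCode.dist_le_of_rk_lt {D : Submodule E (ι → E)} {n k d : ℕ}
    (hD : IsLinearCode D n k d) {T : Finset ι} (hT : rk E (coordFunctional D) T < k) :
    d + k + T.card ≤ n + 1 + rk E (coordFunctional D) T := by
  classical
  have h1 := le_rk_univ D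
  rw [hD.dim_eq] at h1
  have hle : rk E (coordFunctional D) Finset.univ ≤
      rk E (coordFunctional D) T + (Finset.univ \ T).card := by
    have h2 := rk_union_le (E := E) (coordFunctional D) T (Finset.univ \ T)
    rw [Finset.union_sdiff_of_subset (Finset.subset_univ T)] at h2
    exact h2.trans (Nat.add_le_add_left (rk_le_card _ _) _)
  -- Padding `T` with k - 1 - rk T elements keeps the rank below k, so a nonzero codeword vanishes
  -- on the padded set.
  obtain ⟨Y, hYsub, hY⟩ := Finset.exists_subset_card_eq
    (show k - 1 - rk E (coordFunctional D) T ≤ (Finset.univ \ T).card by omega)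
  have hdisj : Disjoint T Y := Finset.disjoint_left.2 fun i hi hiY =>
    (Finset.mem_sdiff.1 (hYsub hiY)).2 hi
  have hrk : rk E (coordFunctional D) (T ∪ Y) < finrank E D := by
    have h2 := rk_union_le (E := E) (coordFunctional D) T Y
    have h3 := rk_le_card (E := E) (coordFunctional D) Y
    rw [hD.dim_eq]
    omega
  obtain ⟨x, hxD, hx0, hx⟩ := exists_ne_zero_of_rk_lt hrk
  have h4 : d ≤ hammingDist x 0 := by
    convert hD.dist_isLeast.2 ⟨x, hxD, 0, D.zero_mem, hx0, rfl⟩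
  have h5 : hammingDist x 0 ≤ (Finset.univ \ (T ∪ Y)).card := by
    rw [hammingDist_zero_right, hammingNorm]
    refine Finset.card_le_card fun i hi => ?_
    rw [Finset.mem_sdiff]
    exact ⟨Finset.mem_univ i, fun h => (Finset.mem_filter.1 hi).2 (hx i h)⟩
  have h6 := Finset.card_sdiff_add_card_eq_card (Finset.subset_univ (T ∪ Y))
  rw [Finset.card_univ, hD.length_eq, Finset.card_union_of_disjoint hdisj] at h6
  omega

/-- The bound on the minimum distance of codes with all-symbol locality. -/
theorem dist_le_of_locality {D : Submodule E (ι → E)} {n k d r δ w m u v : ℕ}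
    (hD : IsLinearCode D n k d) (hloc : HasAllSymbolLocality D r δ)
    (hδ : 2 ≤ δ) (hn : n = w * (r + δ - 1) + m) (hδm : δ ≤ m) (hm : m < r + δ - 1)
    (hk : k = u * r + v) (hvr : v < r) (hmv : m - δ + 1 < v) (hv : r < 2 * v)
    (hu1 : 2 * (r + δ - 1 - m) ≤ u) (hu2 : δ - 1 ≤ u) :
    d + k + (u + 1) * (δ - 1) ≤ n + 1 := by
  classical
  by_contra hlt
  refine not_hasSmallNullity (E := E) (φ := coordFunctional D) hδ (hD.length_eq.trans hn) hδm hm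
    hvr hmv hv hu1 hu2 ⟨fun i => ?_, ?_, fun T hT => ?_⟩
  · obtain ⟨B, hiB, hB⟩ := hloc i
    exact ⟨B, hiB, hB.isSpanRepair⟩
  · rw [← hk, ← hD.dim_eq]
    exact le_rk_univ D
  · have := hD.dist_le_of_rk_lt (hk ▸ hT)
    omega

end Code

end LRCBound

open Module

/-! ### Moore matrices -/

section Moore

variable {F K : Type*} [Field F] [Fintype F] [Field K] [Algebra F K]

/-- The `e`-th power of the Frobenius map is linear over `F`. -/
theorem sum_smul_pow_card_pow {ι : Type*} (s : Finset ι) (a : ι → F) (β : ι → K) (e : ℕ) :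
    (∑ i ∈ s, a i • β i) ^ Fintype.card F ^ e =
      ∑ i ∈ s, a i • β i ^ Fintype.card F ^ e := by
  induction e with
  | zero => simp
  | succ e ih =>
    simp only [pow_succ (Fintype.card F), pow_mul]
    rw [ih]
    simpa only [map_smul, FiniteField.frobeniusAlgHom_apply] using
      map_sum (FiniteField.frobeniusAlgHom F K) (fun i => a i • β i ^ Fintype.card F ^ e) s

/-- A left kernel vector gives the coefficients of a q-polynomial of degree at most q^(s-1) that
vanishes at all F-combinations of the β_l. By independence these are q^s distinct points, so the
polynomial is zero. -/
theorem det_mooreMatrix_ne_zero {s : ℕ} {β : Fin s → K} (hβ : LinearIndependent F β) :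
    (mooreMatrix (Fintype.card F) s β).det ≠ 0 := by
  classical
  intro hdet
  obtain ⟨c, hc0, hc⟩ := Matrix.exists_vecMul_eq_zero_iff.2 hdet
  have hq : 1 < Fintype.card F := Fintype.one_lt_card
  set P : Polynomial K := ∑ e : Fin s, Polynomial.monomial (Fintype.card F ^ (e : ℕ)) (c e) with hP
  have hPeval : ∀ a : Fin s → F, P.eval (∑ l, a l • β l) = 0 := by
    intro a
    simp only [hP, Polynomial.eval_finsetSum, Polynomial.eval_monomial]
    calc ∑ e : Fin s, c e * (∑ l, a l • β l) ^ Fintype.card F ^ (e : ℕ)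
        = ∑ e : Fin s, ∑ l, a l • (c e * β l ^ Fintype.card F ^ (e : ℕ)) := by
          refine Finset.sum_congr rfl fun e _ => ?_
          rw [sum_smul_pow_card_pow, Finset.mul_sum]
          simp only [mul_smul_comm]
      _ = ∑ l, a l • ∑ e : Fin s, c e * β l ^ Fintype.card F ^ (e : ℕ) := by
          rw [Finset.sum_comm]
          simp only [Finset.smul_sum]
      _ = 0 := by
          refine Finset.sum_eq_zero fun l _ => ?_
          have : ∑ e : Fin s, c e * β l ^ Fintype.card F ^ (e : ℕ) = 0 := congrFun hc l
          rw [this, smul_zero]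
  have hdeg : P.natDegree < Fintype.card (Fin s → F) := by
    rw [Fintype.card_fun, Fintype.card_fin, hP]
    rcases s with _ | s
    · simp
    · refine lt_of_le_of_lt (Polynomial.natDegree_sum_le_of_forall_le _ _
        (n := Fintype.card F ^ s) fun e _ => (Polynomial.natDegree_monomial_le _).trans ?_) ?_
      · exact Nat.pow_le_pow_right hq.le (Nat.lt_succ_iff.1 e.2)
      · exact Nat.pow_lt_pow_right hq (Nat.lt_succ_self s)
  have hP0 : P = 0 := Polynomial.eq_zero_of_natDegree_lt_card_of_eval_eq_zero P
    (f := fun a : Fin s → F => ∑ l, a l • β l)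
    (linearIndependent_iff_injective_fintypeLinearCombination.1 hβ) hPeval hdeg
  refine hc0 (funext fun e => ?_)
  have := congrArg (fun p => p.coeff (Fintype.card F ^ (e : ℕ))) hP0
  simp only [hP, Polynomial.finsetSum_coeff, Polynomial.coeff_monomial,
    Polynomial.coeff_zero] at this
  rw [Finset.sum_eq_single e] at this
  · simpa using this
  · intro e' _ hne
    refine if_neg fun h => hne (Fin.ext (Nat.pow_right_injective hq h))
  · simp

end Moore

/-! ### Block checks, locality and local words -/

namespace ConstructionA

variable {F : Type*} [Field F] {r δ m w : ℕ}

/-- The column of `A` that belongs to a coordinate. -/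
def colOf (p : Coord r δ m w) : Fin (r + δ - 1) :=
  Fin.castLE (blockSize_le r δ m p.1) p.2

theorem eq_of_colOf_eq {p q : Coord r δ m w} (h : p.1 = q.1) (hc : colOf p = colOf q) : p = q := by
  obtain ⟨i, p⟩ := p
  obtain ⟨i', q⟩ := q
  obtain rfl : i = i' := h
  simpa [colOf] using hc

/-- The parity checks of the diagonal blocks. -/
def LocalCheck {L : Type*} [Field L] [Algebra F L] (A : Matrix (Fin (δ - 1)) (Fin (r + δ - 1)) F)
    (x : Coord r δ m w → L) : Prop :=
  ∀ i a, ∑ p : Coord r δ m w, (if i = p.1 then algebraMap F L (A a (colOf p)) else 0) * x p = 0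

theorem mem_code_iff [Fintype F] {K : Type*} [Field K] [Algebra F K] {h : ℕ}
    {A : Matrix (Fin (δ - 1)) (Fin (r + δ - 1)) F} {α x : Coord r δ m w → K} :
    x ∈ code r δ m w h A α ↔
      LocalCheck A x ∧ ∀ e : Fin h, ∑ p, α p ^ Fintype.card F ^ (e : ℕ) * x p = 0 := by
  rw [code, parityCheckCode, LinearMap.mem_ker, Matrix.mulVecLin_apply, parityCheck,
    Matrix.fromRows_mulVec, funext_iff, Sum.forall, Prod.forall]
  rfl

theorem _root_.IsLinearCode.eq_zero_of_card_lt {ι L : Type*} [Fintype ι] [Field L]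
    {C : Submodule L (ι → L)} {n k d : ℕ} (hC : IsLinearCode C n k d) {y : ι → L} (hy : y ∈ C)
    {J : Finset ι} (hJ : J.card < d) (hyJ : ∀ i ∉ J, y i = 0) : y = 0 := by
  classical
  by_contra hne
  have h1 : d ≤ hammingDist y 0 := by
    convert hC.dist_isLeast.2 ⟨y, hy, 0, C.zero_mem, hne, rfl⟩
  have h2 : hammingDist y 0 ≤ J.card := by
    rw [hammingDist_zero_right, hammingNorm]
    refine Finset.card_le_card fun i hi => ?_
    by_contra hiJ
    exact (Finset.mem_filter.1 hi).2 (hyJ i hiJ)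
  omega

/-- Fewer than `d` columns of a parity-check matrix of a code with distance `d` have a dual
family in the row space. -/
theorem exists_vecMul_eq {ρ ι : Type*} [Fintype ρ] [Fintype ι] {A : Matrix ρ ι F} {n k d : ℕ}
    (hA : IsLinearCode (parityCheckCode A) n k d) {J : Finset ι} (hJ : J.card < d) {l : ι}
    (hl : l ∈ J) : ∃ f : ρ → F, ∑ a, f a * A a l = 1 ∧ ∀ j ∈ J, j ≠ l → ∑ a, f a * A a j = 0 := by
  classical
  -- A relation among these columns is a codeword of weight below d. Independence then yields a
  -- functional that separates column `l` from the others.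
  have hind : LinearIndepOn F (fun j a => A a j) (J : Set ι) := by
    rw [linearIndepOn_finset_iff]
    intro g hg j hj
    have hy : (fun i => if i ∈ J then g i else 0) = 0 := by
      refine hA.eq_zero_of_card_lt ?_ hJ fun i hi => if_neg hi
      rw [parityCheckCode, LinearMap.mem_ker]
      ext a
      have := congrFun hg a
      simpa [Matrix.mulVec, dotProduct, Finset.sum_ite_mem, mul_comm] using this
    simpa [hj] using congrFun hy j
  obtain ⟨f, hfl, hf⟩ := Submodule.exists_le_ker_of_notMem
    (linearIndepOn_iff_notMem_span.1 hind l hl)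
  have hfe : ∀ j, f (fun a => A a j) =
      ∑ a, f (fun b => if a = b then 1 else 0) * A a j := fun j => by
    rw [LinearMap.pi_apply_eq_sum_univ]
    simp [mul_comm]
  refine ⟨fun a => (f fun a => A a l)⁻¹ * f (fun b => if a = b then 1 else 0), ?_, ?_⟩
  · simp only [mul_assoc, ← Finset.mul_sum]
    rw [← hfe, inv_mul_cancel₀ hfl]
  · intro j hj hjl
    simp only [mul_assoc, ← Finset.mul_sum]
    rw [← hfe]
    have : f (fun a => A a j) = 0 :=
      hf (Submodule.subset_span ⟨j, ⟨hj, hjl⟩, rfl⟩)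
    rw [this, mul_zero]

variable {A : Matrix (Fin (δ - 1)) (Fin (r + δ - 1)) F} {k₀ n₀ : ℕ}

/-- Inside a block, fewer than `δ` erased symbols are linear functions of the others. -/
theorem exists_repair {L : Type*} [Field L] [Algebra F L]
    (hA : IsLinearCode (parityCheckCode A) n₀ k₀ δ) {l : Coord r δ m w}
    {P : Finset (Coord r δ m w)} (hl : l ∉ P)
    (hcard : (Finset.univ.filter fun p : Coord r δ m w => p.1 = l.1 ∧ p ∉ P).card < δ) :
    ∃ b : Coord r δ m w → L, ∀ x : Coord r δ m w → L, LocalCheck A x →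
      x l = ∑ p ∈ P, b p * x p := by
  classical
  set J := Finset.univ.filter fun p : Coord r δ m w => p.1 = l.1 ∧ p ∉ P with hJ
  obtain ⟨f, hfl, hf⟩ := exists_vecMul_eq hA (J := J.image colOf)
    (Finset.card_image_le.trans_lt hcard) (l := colOf l)
    (Finset.mem_image_of_mem _ (by simp [hJ, hl]))
  -- A combination of the checks of the block of `l`, with coefficient 1 at `l` and 0 at the other
  -- erased positions.
  set g : Coord r δ m w → L := fun p =>
    if l.1 = p.1 then algebraMap F L (∑ a, f a * A a (colOf p)) else 0 with hg
  have hgl : g l = 1 := by simp only [hg, if_true, hfl, map_one]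
  have hg0 : ∀ p, p ∉ P → p ≠ l → g p = 0 := by
    intro p hpP hpl
    by_cases hp : l.1 = p.1
    · have : ∑ a, f a * A a (colOf p) = 0 := by
        refine hf _ (Finset.mem_image_of_mem _ (by simp [hJ, hp, hpP])) fun h => ?_
        exact hpl (eq_of_colOf_eq hp.symm h)
      simp only [hg, this, map_zero, ite_self]
    · simp [hg, hp]
  refine ⟨fun p => - g p, fun x hx => ?_⟩
  have hsum : ∑ p, g p * x p = 0 := by
    calc ∑ p, g p * x p = ∑ a, algebraMap F L (f a) * ∑ p : Coord r δ m w,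
          (if l.1 = p.1 then algebraMap F L (A a (colOf p)) else 0) * x p := by
          simp only [Finset.mul_sum]
          rw [Finset.sum_comm]
          refine Finset.sum_congr rfl fun p _ => ?_
          by_cases hp : l.1 = p.1
          · simp only [hg, if_pos hp, map_sum, map_mul, Finset.sum_mul, mul_assoc]
          · simp [hg, hp]
      _ = 0 := Finset.sum_eq_zero fun a _ => by rw [hx l.1 a, mul_zero]
  have hsplit : ∑ p ∈ insert l P, g p * x p = 0 := by
    rw [← hsum]
    refine Finset.sum_subset (Finset.subset_univ _) fun p _ hp => ?_
    rw [Finset.mem_insert, not_or] at hp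
    rw [hg0 p hp.2 hp.1, zero_mul]
  rw [Finset.sum_insert hl, hgl, one_mul] at hsplit
  simp only [neg_mul, Finset.sum_neg_distrib]
  exact eq_neg_of_add_eq_zero_left hsplit

theorem card_block (i : Fin (w + 1)) :
    (Finset.univ.filter fun p : Coord r δ m w => p.1 = i).card = blockSize r δ m i := by
  classical
  have : (Finset.univ.filter fun p : Coord r δ m w => p.1 = i) =
      (Finset.univ : Finset (Fin (blockSize r δ m i))).map (Function.Embedding.sigmaMk i) := by
    ext ⟨i', p⟩
    simp only [Finset.mem_filter, Finset.mem_univ, true_and, Finset.mem_map,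
      Function.Embedding.sigmaMk_apply]
    constructor
    · rintro rfl
      exact ⟨p, rfl⟩
    · rintro ⟨a, ha⟩
      exact (congrArg Sigma.fst ha).symm
  rw [this, Finset.card_map, Finset.card_univ, Fintype.card_fin]

theorem hasAllSymbolLocality_code [Fintype F] {K : Type*} [Field K] [Algebra F K] {h : ℕ}
    (hδ : 2 ≤ δ) (hA : IsLinearCode (parityCheckCode A) n₀ k₀ δ) (α : Coord r δ m w → K) :
    HasAllSymbolLocality (code r δ m w h A α) r δ := by
  classical
  intro i
  refine ⟨Finset.univ.filter fun p => p.1 = i.1, by simp, ?_, ?_⟩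
  · rw [card_block]
    exact blockSize_le _ _ _ _
  · intro l hl P hP hlP hcard
    have hl1 : l.1 = i.1 := (Finset.mem_filter.1 hl).2
    obtain ⟨b, hb⟩ := exists_repair (L := K) hA (l := l) (P := P) hlP (by
        have h1 := Finset.card_sdiff_add_card_eq_card hP
        have h2 : (Finset.univ.filter fun p : Coord r δ m w => p.1 = l.1 ∧ p ∉ P) =
            (Finset.univ.filter fun p : Coord r δ m w => p.1 = i.1) \ P := by
          ext p
          simp [hl1]
        rw [h2]
        omega)
    exact ⟨b, fun c hc => hb c (mem_code_iff.1 hc).1⟩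

/-- A word that satisfies the checks of a block and has fewer than `δ` nonzero symbols in it
vanishes on this block. -/
theorem LocalCheck.eq_zero_on_block {L : Type*} [Field L] [Algebra F L]
    (hA : IsLinearCode (parityCheckCode A) n₀ k₀ δ) {x : Coord r δ m w → L} (hx : LocalCheck A x)
    {i : Fin (w + 1)} {J : Finset (Coord r δ m w)} (hJ : J.card < δ)
    (hxJ : ∀ p, p.1 = i → p ∉ J → x p = 0) {l : Coord r δ m w} (hl : l.1 = i) : x l = 0 := by
  classical
  by_cases hlJ : l ∈ J
  · obtain ⟨b, hb⟩ := exists_repair (L := L) hA (l := l)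
      (P := Finset.univ.filter fun p => p.1 = i ∧ p ∉ J) (by simp [hlJ])
      ((Finset.card_le_card fun p hp => by
        simp only [Finset.mem_filter, Finset.mem_univ, true_and, not_and, not_not] at hp
        exact hp.2 (hp.1.trans hl)).trans_lt hJ)
    rw [hb x hx]
    refine Finset.sum_eq_zero fun p hp => ?_
    have hp' := (Finset.mem_filter.1 hp).2
    rw [hxJ p hp'.1 hp'.2, mul_zero]
  · exact hxJ l hl hlJ

/-- The words over `F` that satisfy the block checks and are supported in `T`. -/
def localWords (A : Matrix (Fin (δ - 1)) (Fin (r + δ - 1)) F) (T : Finset (Coord r δ m w)) :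
    Submodule F (Coord r δ m w → F) where
  carrier := {y | LocalCheck A y ∧ ∀ p ∉ T, y p = 0}
  zero_mem' := ⟨fun i a => by simp, fun _ _ => rfl⟩
  add_mem' := by
    rintro y z ⟨hy, hyT⟩ ⟨hz, hzT⟩
    refine ⟨fun i a => ?_, fun p hp => by simp [hyT p hp, hzT p hp]⟩
    simp only [Pi.add_apply, mul_add, Finset.sum_add_distrib]
    rw [hy i a, hz i a, add_zero]
  smul_mem' := by
    rintro c y ⟨hy, hyT⟩
    refine ⟨fun i a => ?_, fun p hp => by simp [hyT p hp]⟩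
    simp only [Pi.smul_apply, smul_eq_mul, mul_left_comm _ c, ← Finset.mul_sum]
    rw [hy i a, mul_zero]

/-- In each block, δ - 1 positions of `T` (or all, if there are fewer) are determined by the
remaining ones, so restriction to the rest of `T` is injective. -/
theorem finrank_localWords_le (hδ : 2 ≤ δ) (hA : IsLinearCode (parityCheckCode A) n₀ k₀ δ)
    (T : Finset (Coord r δ m w)) :
    finrank F (localWords A T) ≤
      ∑ i : Fin (w + 1), ((T.filter fun p => p.1 = i).card - (δ - 1)) := by
  classical
  choose J hJT hJ using fun i : Fin (w + 1) => Finset.exists_subset_card_eq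
    (Nat.min_le_right (δ - 1) (T.filter fun p => p.1 = i).card)
  set R : Finset (Coord r δ m w) :=
    Finset.univ.biUnion fun i => (T.filter fun p => p.1 = i) \ J i with hR
  have hRcard : R.card ≤ ∑ i : Fin (w + 1), ((T.filter fun p => p.1 = i).card - (δ - 1)) := by
    refine Finset.card_biUnion_le.trans (Finset.sum_le_sum fun i _ => ?_)
    have := Finset.card_sdiff_add_card_eq_card (hJT i)
    have := hJ i
    omega
  let f : localWords A T →ₗ[F] (R → F) :=
    (LinearMap.funLeft F F (fun p : R => (p : Coord r δ m w))).comp (localWords A T).subtype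
  have hf : Function.Injective f := by
    rw [← LinearMap.ker_eq_bot, LinearMap.ker_eq_bot']
    rintro ⟨y, hy, hyT⟩ h0
    ext l
    refine hy.eq_zero_on_block hA (i := l.1) (J := J l.1) (by have := hJ l.1; omega) ?_ rfl
    intro p hp hpJ
    by_cases hpT : p ∈ T
    · have hpR : p ∈ R := by
        simp only [hR, Finset.mem_biUnion, Finset.mem_univ, true_and, Finset.mem_sdiff,
          Finset.mem_filter]
        exact ⟨l.1, ⟨hpT, hp⟩, hpJ⟩
      exact congrFun h0 ⟨p, hpR⟩
    · exact hyT p hpT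
  have := LinearMap.finrank_le_finrank_of_injective hf
  rw [finrank_fintype_fun_eq_card, Fintype.card_coe] at this
  exact this.trans hRcard

/-! ### Codewords of small support vanish -/

section

variable {K : Type*} [Fintype F] [Field K] [Algebra F K] [FiniteDimensional F K]

/-- The columns of the parity-check matrix that belong to `T` are independent. -/
theorem eq_zero_of_mem_code {h : ℕ} {α : Coord r δ m w → K} {T : Finset (Coord r δ m w)}
    (hT : LinearIndepOn F α (T : Set (Coord r δ m w))) (hdim : finrank F (localWords A T) ≤ h)
    {x : Coord r δ m w → K} (hx : x ∈ code r δ m w h A α) (hxT : ∀ p ∉ T, x p = 0) : x = 0 := by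
  classical
  obtain ⟨hloc, hmoore⟩ := mem_code_iff.1 hx
  set e := finBasis F K
  set g := finBasis F (localWords A T)
  -- The block checks have coefficients in `F`, so they hold for each coordinate of `x` in an
  -- F-basis of `K`.
  have hy : ∀ t, (fun p => e.repr (x p) t) ∈ localWords A T := by
    intro t
    refine ⟨fun i a => ?_, fun p hp => by simp [hxT p hp]⟩
    have h1 := congrArg (fun z => e.coord t z) (hloc i a)
    simp only [map_sum, map_zero] at h1
    refine (Finset.sum_congr rfl fun p _ => ?_).trans h1
    split_ifs
    · rw [Algebra.algebraMap_self_apply, ← Algebra.smul_def (A a (colOf p)) (x p), map_smul]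
      rfl
    · simp
  set y : Fin (finrank F K) → localWords A T := fun t => ⟨_, hy t⟩ with hydef
  set z : Fin (finrank F (localWords A T)) → K := fun l => ∑ t, g.repr (y t) l • e t with hz
  set β : Fin (finrank F (localWords A T)) → K := fun l => ∑ p, (g l : Coord r δ m w → F) p • α p
    with hβ
  have hxz : ∀ p, x p = ∑ l, (g l : Coord r δ m w → F) p • z l := by
    intro p
    have h1 : ∀ t, e.repr (x p) t = ∑ l, g.repr (y t) l * (g l : Coord r δ m w → F) p := by
      intro t
      change (y t : Coord r δ m w → F) p = _
      conv_lhs => rw [← g.sum_repr (y t)]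
      simp only [Submodule.coe_sum, Submodule.coe_smul, Finset.sum_apply, Pi.smul_apply,
        smul_eq_mul]
    conv_lhs => rw [← e.sum_repr (x p)]
    simp only [hz, Finset.smul_sum, h1, Finset.sum_smul]
    rw [Finset.sum_comm]
    simp only [smul_smul, mul_comm]
  have hβind : LinearIndependent F β := by
    let Ψ : localWords A T →ₗ[F] K :=
      (Fintype.linearCombination F α).comp (localWords A T).subtype
    have hΨ : LinearMap.ker Ψ = ⊥ := by
      rw [LinearMap.ker_eq_bot']
      rintro ⟨y, hy, hyT⟩ h0
      have h1 : ∑ p ∈ T, y p • α p = 0 := by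
        have h2 : ∑ p, y p • α p = 0 := h0
        rw [← h2]
        exact Finset.sum_subset (Finset.subset_univ _) fun p _ hp => by rw [hyT p hp, zero_smul]
      ext p
      by_cases hp : p ∈ T
      · exact linearIndepOn_finset_iff.1 hT y h1 p hp
      · exact hyT p hp
    exact g.linearIndependent.map' Ψ hΨ
  have hz0 : z = 0 := by
    -- The first s of the h global checks suffice, s being the dimension of the local words. As
    -- q^e-th powers are F-linear, they turn the α_p into the β_l.
    refine Matrix.eq_zero_of_mulVec_eq_zero (det_mooreMatrix_ne_zero hβind) (funext fun ε => ?_)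
    have h1 := hmoore (Fin.castLE hdim ε)
    rw [Pi.zero_apply, ← h1]
    calc ∑ l, β l ^ Fintype.card F ^ (ε : ℕ) * z l
        = ∑ l, ∑ p, α p ^ Fintype.card F ^ (ε : ℕ) * ((g l : Coord r δ m w → F) p • z l) := by
          refine Finset.sum_congr rfl fun l _ => ?_
          rw [hβ, sum_smul_pow_card_pow, Finset.sum_mul]
          simp only [smul_mul_assoc, mul_smul_comm]
      _ = _ := by
          rw [Finset.sum_comm]
          refine Finset.sum_congr rfl fun p _ => ?_
          rw [hxz p, Finset.mul_sum]
          rfl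
  ext p
  rw [hxz p]
  simp [hz0]

end

end ConstructionA

/-! ### Counting over blocks and the dimension of the code -/

open Module

namespace ConstructionA

variable {r δ m w : ℕ}

/-- A set of at most `h + c * (δ - 1)` coordinates contributes at most `h` dimensions of local
words. -/
theorem sum_card_block_sub_le {h c : ℕ} (hδ : 2 ≤ δ) (hc : c * r ≤ h + r)
    {T : Finset (Coord r δ m w)} (hT : T.card ≤ h + c * (δ - 1)) :
    ∑ i : Fin (w + 1), ((T.filter fun p => p.1 = i).card - (δ - 1)) ≤ h := by
  classical
  set I : Finset (Fin (w + 1)) :=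
    Finset.univ.filter fun i => δ - 1 < (T.filter fun p => p.1 = i).card with hI
  have hsum : ∑ i : Fin (w + 1), ((T.filter fun p => p.1 = i).card - (δ - 1)) =
      ∑ i ∈ I, ((T.filter fun p => p.1 = i).card - (δ - 1)) := by
    refine (Finset.sum_subset (Finset.subset_univ _) fun i _ hi => ?_).symm
    have : ¬ δ - 1 < (T.filter fun p => p.1 = i).card := fun hlt =>
      hi (Finset.mem_filter.2 ⟨Finset.mem_univ _, hlt⟩)
    omega
  rw [hsum]
  -- With at least c blocks in `I`, the subtracted terms δ - 1 bring the sum down to h. With at most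
  -- c - 1, each block contributes at most r, and (c - 1)r ≤ h.
  rcases le_or_gt c I.card with hcI | hcI
  · have h1 : ∑ i ∈ I, ((T.filter fun p => p.1 = i).card - (δ - 1)) + I.card * (δ - 1) =
        ∑ i ∈ I, (T.filter fun p => p.1 = i).card := by
      rw [← smul_eq_mul, ← Finset.sum_const, ← Finset.sum_add_distrib]
      refine Finset.sum_congr rfl fun i hi => ?_
      have := (Finset.mem_filter.1 hi).2
      omega
    have h2 : ∑ i ∈ I, (T.filter fun p => p.1 = i).card ≤ T.card := by
      rw [Finset.card_eq_sum_card_fiberwise (f := Sigma.fst) (t := Finset.univ)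
        (fun _ _ => Finset.mem_coe.2 (Finset.mem_univ _))]
      exact Finset.sum_le_sum_of_subset (Finset.subset_univ _)
    have h3 := Nat.mul_le_mul_right (δ - 1) hcI
    omega
  · have h1 : ∑ i ∈ I, ((T.filter fun p => p.1 = i).card - (δ - 1)) ≤ I.card * r := by
      refine Finset.sum_le_card_nsmul _ _ _ fun i _ => ?_
      have h2 : (T.filter fun p => p.1 = i).card ≤ r + δ - 1 :=
        (Finset.card_le_card (Finset.filter_subset_filter _ (Finset.subset_univ T))).trans
          ((card_block i).le.trans (blockSize_le _ _ _ _))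
      omega
    have h3 := Nat.mul_le_mul_right r (Nat.succ_le_of_lt hcI)
    rw [Nat.succ_eq_add_one, add_one_mul] at h3
    omega

variable {F K : Type*} [Field F] [Fintype F] [Field K] [Algebra F K]
  {A : Matrix (Fin (δ - 1)) (Fin (r + δ - 1)) F} {k₀ n₀ h : ℕ} {α : Coord r δ m w → K}

theorem le_finrank_code :
    Fintype.card (Coord r δ m w) ≤
      finrank K (code r δ m w h A α) + ((w + 1) * (δ - 1) + h) := by
  have h1 := LinearMap.finrank_range_add_finrank_ker (parityCheck r δ m w h A α).mulVecLin
  have h2 := Submodule.finrank_le (LinearMap.range (parityCheck r δ m w h A α).mulVecLin)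
  simp only [finrank_fintype_fun_eq_card, Fintype.card_sum, Fintype.card_prod,
    Fintype.card_fin] at h1 h2
  rw [code, parityCheckCode]
  omega

/-- If no nonzero codeword has weight at most `t`, then the code is determined by its symbols
outside of a set of `t + (u + 1) * (δ - 1)` coordinates. -/
theorem finrank_code_le {t u : ℕ} (hδ : 2 ≤ δ) (hA : IsLinearCode (parityCheckCode A) n₀ k₀ δ)
    (hr : 1 ≤ r) (huw : u < w) (hu : r + δ - 1 - m ≤ u + 1) (ht : t ≤ (w - u) * (r + δ - 1))
    (hdist : ∀ T : Finset (Coord r δ m w), T.card ≤ t → ∀ x ∈ code r δ m w h A α,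
      (∀ p ∉ T, x p = 0) → x = 0) :
    finrank K (code r δ m w h A α) + (t + (u + 1) * (δ - 1)) ≤
      Fintype.card (Coord r δ m w) := by
  classical
  -- Only the first r + δ - 1 - m ≤ u + 1 blocks are shortened, so all blocks after `i₀` have full
  -- length and can hold the t erasures `T`.
  set i₀ : Fin (w + 1) := ⟨u, by omega⟩ with hi₀
  set Q₀ : Finset (Coord r δ m w) := (Finset.Ioi i₀).sigma fun _ => Finset.univ with hQ₀
  have hQ₀card : Q₀.card = (w - u) * (r + δ - 1) := by
    rw [hQ₀, Finset.card_sigma, Finset.sum_congr rfl (g := fun _ => r + δ - 1)]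
    · rw [Finset.sum_const, Fin.card_Ioi, smul_eq_mul, hi₀]
      congr 1
    · intro i hi
      have hi' : i₀ < i := Finset.mem_Ioi.1 hi
      have : u < (i : ℕ) := hi'
      rw [Finset.card_univ, Fintype.card_fin, blockSize, if_neg (by omega)]
  obtain ⟨T, hTQ₀, hT⟩ := Finset.exists_subset_card_eq (hQ₀card ▸ ht)
  have hblock : ∀ i : Fin (w + 1),
      δ - 1 ≤ (Finset.univ : Finset (Fin (blockSize r δ m i))).card := by
    intro i
    rw [Finset.card_univ, Fintype.card_fin, blockSize]
    split <;> omega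
  choose J _ hJ using fun i => Finset.exists_subset_card_eq (hblock i)
  set Q₁ : Finset (Coord r δ m w) := (Finset.Iic i₀).sigma J with hQ₁
  have hQ₁card : Q₁.card = (u + 1) * (δ - 1) := by
    rw [hQ₁, Finset.card_sigma, Finset.sum_congr rfl fun i _ => hJ i, Finset.sum_const,
      Fin.card_Iic, smul_eq_mul]
  have hdisj : Disjoint T Q₁ := by
    refine Finset.disjoint_left.2 fun p hp hp' => ?_
    have h1 := (Finset.mem_sigma.1 (hTQ₀ hp)).1
    have h2 := (Finset.mem_sigma.1 hp').1
    exact absurd (Finset.mem_Ioi.1 h1) (not_lt.2 (Finset.mem_Iic.1 h2))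
  set R := Finset.univ \ (T ∪ Q₁) with hR
  have hRcard := Finset.card_sdiff_add_card_eq_card (Finset.subset_univ (T ∪ Q₁))
  rw [Finset.card_union_of_disjoint hdisj, hT, hQ₁card, Finset.card_univ, ← hR] at hRcard
  let f : code r δ m w h A α →ₗ[K] (R → K) :=
    (LinearMap.funLeft K K (fun p : R => (p : Coord r δ m w))).comp
      (code r δ m w h A α).subtype
  have hf : Function.Injective f := by
    rw [← LinearMap.ker_eq_bot, LinearMap.ker_eq_bot']
    rintro ⟨x, hx⟩ h0
    have hxR : ∀ p, p ∉ T → p ∉ Q₁ → x p = 0 := fun p hpT hpQ =>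
      congrFun h0 ⟨p, by simp [hR, hpT, hpQ]⟩
    -- Each block up to `i₀` has only δ - 1 erasures, which the block checks fill with zeros. What
    -- remains is supported on `T`.
    refine Subtype.ext (hdist T hT.le x hx fun p hp => ?_)
    by_cases hpQ : p ∈ Q₁
    · have hpi := (Finset.mem_sigma.1 hpQ).1
      refine (mem_code_iff.1 hx).1.eq_zero_on_block hA (i := p.1)
        (J := (J p.1).map (Function.Embedding.sigmaMk p.1))
        (by rw [Finset.card_map, hJ]; omega) (fun p' hp' hpJ => ?_) rfl
      refine hxR p' (fun hT' => ?_) fun hQ' => hpJ ?_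
      · have h1 := Finset.mem_Ioi.1 (Finset.mem_sigma.1 (hTQ₀ hT')).1
        rw [hp'] at h1
        exact absurd h1 (not_lt.2 (Finset.mem_Iic.1 hpi))
      · obtain ⟨i, a⟩ := p'
        obtain rfl : i = p.1 := hp'
        exact Finset.mem_map_of_mem _ (Finset.mem_sigma.1 hQ').2
    · exact hxR p hp hpQ
  have := LinearMap.finrank_le_finrank_of_injective hf
  rw [finrank_fintype_fun_eq_card, Fintype.card_coe] at this
  omega

end ConstructionA

/-! ### Parameters, exact distance and optimality -/

theorem IsWiseIndependent.linearIndepOn {F K ι : Type*} [Field F] [Field K] [Algebra F K] {t : ℕ}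
    {S : Set K} (hS : IsWiseIndependent F t S) {α : ι → K} (hα : Function.Injective α)
    (hαS : ∀ i, α i ∈ S) {T : Finset ι} (hT : T.card ≤ t) : LinearIndepOn F α (T : Set ι) := by
  classical
  rw [linearIndepOn_iff_image hα.injOn]
  have := hS (T.image α) (by
      rw [Finset.coe_image, Set.image_subset_iff]
      exact fun i _ => hαS i)
    (Finset.card_image_le.trans hT)
  rw [← Finset.coe_image]
  exact this

/-- A nonzero code has a minimum distance. -/
theorem exists_isLinearCode {ι L : Type*} [Fintype ι] [Field L] (C : Submodule L (ι → L))
    (hC : 0 < finrank L C) : ∃ d, IsLinearCode C (Fintype.card ι) (finrank L C) d := by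
  classical
  have hne : C ≠ ⊥ := by
    rintro rfl
    simp at hC
  obtain ⟨x, hx, hx0⟩ := Submodule.exists_mem_ne_zero_of_ne_bot hne
  have hex : ∃ e, ∃ x ∈ C, ∃ y ∈ C, x ≠ y ∧ hammingDist x y = e :=
    ⟨_, x, hx, 0, C.zero_mem, hx0, rfl⟩
  refine ⟨Nat.find hex, rfl, rfl, ?_, ?_⟩
  · obtain ⟨x, hx, y, hy, hxy, he⟩ := Nat.find_spec hex
    refine ⟨x, hx, y, hy, hxy, ?_⟩
    convert he
  · rintro e ⟨x, hx, y, hy, hxy, he⟩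
    refine Nat.find_min' hex ⟨x, hx, y, hy, hxy, ?_⟩
    convert he

theorem theorem3 {F : Type v} {K : Type u} [Field F] [Fintype F] [Field K] [Fintype K]
    [Algebra F K]
    (n k r δ w m u v h : ℕ)
    (hδ : 2 ≤ δ)
    (hn : n = w * (r + δ - 1) + m) (hδm : δ ≤ m) (hm : m < r + δ - 1)
    (hk : k = u * r + v) (hvr : v < r) (hv : max (m - δ + 1) (r / 2) < v)
    (hu : max (2 * (r + δ - 1 - m)) (r + δ - 1) ≤ u)
    (hh : (h : ℤ) = (n : ℤ) - k - (w + 1) * ((δ : ℤ) - 1))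
    (A : Matrix (Fin (δ - 1)) (Fin (r + δ - 1)) F)
    (hA : IsLinearCode (parityCheckCode A) (r + δ - 1) r δ)
    (S : Finset K) (hS : S.card = n)
    (hind : IsWiseIndependent F (h + (w - u) * (δ - 1)) (S : Set K))
    (α : ConstructionA.Coord r δ m w ≃ S) :
    IsOptimalLRC (ConstructionA.code r δ m w h A (fun j => (α j : K)))
      n k (h + (w - u) * (δ - 1) + 1) r δ := by
  classical
  obtain ⟨hmv, hrv⟩ := max_lt_iff.1 hv
  obtain ⟨hu1, hu2⟩ := max_le_iff.1 hu
  have hcard : Fintype.card (ConstructionA.Coord r δ m w) = n := by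
    rw [Fintype.card_congr α, Fintype.card_coe, hS]
  have hD : w * (r + δ - 1) = w * r + w * (δ - 1) := by
    rw [← mul_add]
    congr 1
    omega
  have hnk : n = h + k + (w + 1) * (δ - 1) := by
    zify [show 1 ≤ δ by omega]
    linarith
  have hw1 : (w + 1) * (δ - 1) = w * (δ - 1) + (δ - 1) := add_one_mul _ _
  -- If w ≤ u, the formula for n would give m ≥ v + δ - 1, against m - δ + 1 < v.
  have huw : u < w := by
    by_contra hle
    have := Nat.mul_le_mul_right r (not_lt.1 hle)
    omega
  obtain ⟨c, rfl⟩ := Nat.exists_eq_add_of_le huw.le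
  have e1 : (u + c) * r = u * r + c * r := add_mul _ _ _
  have e2 : (u + c) * (δ - 1) = u * (δ - 1) + c * (δ - 1) := add_mul _ _ _
  have e3 : (u + 1) * (δ - 1) = u * (δ - 1) + (δ - 1) := add_one_mul _ _
  have e4 : c * (r + δ - 1) = c * r + c * (δ - 1) := by
    rw [← mul_add]
    congr 1
    omega
  rw [Nat.add_sub_cancel_left] at hind ⊢
  set C := ConstructionA.code r δ m (u + c) h A (fun j => (α j : K)) with hC
  have hdist : ∀ T : Finset (ConstructionA.Coord r δ m (u + c)), T.card ≤ h + c * (δ - 1) →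
      ∀ x ∈ C, (∀ p ∉ T, x p = 0) → x = 0 := by
    intro T hT x hx hxT
    refine ConstructionA.eq_zero_of_mem_code
      (hind.linearIndepOn (Subtype.val_injective.comp α.injective) (fun j => (α j).2) hT) ?_ hx hxT
    -- Here c * r = h + v - (m - δ + 1), which is at most h + r and, for the dimension count below,
    -- at least h.
    exact (ConstructionA.finrank_localWords_le hδ hA T).trans
      (ConstructionA.sum_card_block_sub_le hδ (by omega) hT)
  have hdim : finrank K C = k := by
    have h1 : Fintype.card (ConstructionA.Coord r δ m (u + c)) ≤ _ :=
      ConstructionA.le_finrank_code (h := h) (A := A) (α := fun j => (α j : K))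
    have h2 := ConstructionA.finrank_code_le (t := h + c * (δ - 1)) hδ hA (by omega) huw
      (by omega) (by rw [Nat.add_sub_cancel_left]; omega) hdist
    rw [← hC] at h1 h2
    omega
  have hloc : HasAllSymbolLocality C r δ := ConstructionA.hasAllSymbolLocality_code hδ hA _
  -- The index type is left arbitrary because the bound serves twice: for the competitors on `Fin
  -- n`, and for `C` itself, whose distance it caps from above.
  have hbound : ∀ {ι : Type} {E : Type u} [Fintype ι] [Field E] (D : Submodule E (ι → E)) (d' : ℕ),
      IsLinearCode D n k d' → HasAllSymbolLocality D r δ → d' ≤ h + c * (δ - 1) + 1 := by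
    intro ι E _ _ D d' hD' hlocD
    have := LRCBound.dist_le_of_locality hD' hlocD hδ hn hδm hm hk hvr hmv (by omega) hu1 (by omega)
    omega
  refine ⟨?_, hloc, fun E _ _ D d' hD' hlocD => hbound D d' hD' hlocD⟩
  obtain ⟨d, hd⟩ := exists_isLinearCode C (by omega)
  rw [hcard, hdim] at hd
  have hle := hbound C d hd hloc
  have hge : h + c * (δ - 1) + 1 ≤ d := by
    obtain ⟨x, hx, y, hy, hxy, hdxy⟩ := hd.dist_isLeast.1
    by_contra hlt
    refine hxy (sub_eq_zero.1 (hdist (Finset.univ.filter fun p => x p ≠ y p) ?_ (x - y)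
      (C.sub_mem hx hy) fun p hp => ?_))
    · have : hammingDist x y = d := by convert hdxy
      rw [hammingDist] at this
      omega
    · simpa [sub_eq_zero] using hp
  rwa [le_antisymm hge hle]
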